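/- \textbf{Setting.} For $v\in\mathbb R^3$ let $v^\times\in\mathfrak{so}(3)$ be the skew-symmetric matrix with $v^\times w=v\times w$, and let $\mathrm{vex}:\mathfrak{so}(3)\to\mathbb R^3$ be the inverse of $v\mapsto v^\times$. Let $\langle A,B\rangle=\mathrm{trace}(A^{T}B)$. Let $E\in\mathbb R^{3\times n}$ (its columns are the known inertial vectors), let $W\in\mathbb R^{n\times n}$ be symmetric positive definite, let $D\in\mathbb R^{3\times 3}$ be symmetric positive definite, let $m>0$ and $t_0<T$, and let $U^m:[t_0,T]\to\mathbb R^{3\times n}$ and $\Omega^m:[t_0,T]\to\mathbb R^3$ be continuous (the measured body-frame vectors and the measured angular velocity). Let $\Phi:[0,\infty)\to[0,\infty)$ be $C^2$ with $\Phi(0)=0$ and $\Phi'(x)>0$ for all $x\ge 0$. Wahba's cost is $$\mathcal U^0(\hat R,U^m)=\tfrac12\langle E-\hat RU^m,(E-\hat RU^m)W\rangle ,$$ and for a $C^1$ curve $\hat R:[t_0,T]\to SO(3)$ with body angular velocity $\hat\Omega$, i.e. $\dot{\hat R}=\hat R\hat\Omega^\times$, the action is $$\mathcal S(\hat R,\hat\Omega)=\int_{t_0}^T\Big\{\tfrac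 m2|\Omega^m-\hat\Omega|^2-\Phi\big(\mathcal U^0(\hat R,U^m)\big)\Big\}\,dt .$$ A variation of $\hat R$ with fixed end points is a family of $C^1$ curves $R_\varepsilon:[t_0,T]\to SO(3)$, $|\varepsilon|<\delta$, with $R_0=\hat R$, $R_\varepsilon(t_0)=\hat R(t_0)$, $R_\varepsilon(T)=\hat R(T)$, such that $R_\varepsilon(t)$ and the angular velocity $\Omega_\varepsilon(t)$ of $R_\varepsilon$ (given by $\partial_tR_\varepsilon=R_\varepsilon\Omega_\varepsilon^\times$) are differentiable in $\varepsilon$ with derivatives continuous in $(\varepsilon,t)$. Its variation vector $\Sigma:[t_0,T]\to\mathbb R^3$ is given by $\partial_\varepsilon R_\varepsilon|_{\varepsilon=0}=\hat R\Sigma^\times$. The curve $(\hat R,\hat\Omega)$ satisfies the Lagrange--d'Alembert principle with dissipation term $\tau_D=D(\Omega^m-\hat\Omega)$ if for every such variation $\delta\mathcal S=\frac{d}{d\varepsilon}\big|_{\varepsilon=0}\mathcal S(R_\varepsilon,\Omega_\varepsilon)$ exists and $$\delta\mathcal S+\int_{t_0}^T\tau_D^{T}\,\Sigma\,dt=0 .$$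 \textbf{Proposition.} Let $\hat R:[t_0,T]\to\mathbb R^{3\times3}$ and $\hat\Omega,\omega:[t_0,T]\to\mathbb R^3$ be functions, and let $\hat R_0\in\mathbb R^{3\times 3}$ and $\hat\Omega_0\in\mathbb R^3$. The following are equivalent. (i) $\hat R$ is a $C^1$ curve in $SO(3)$ with body angular velocity $\hat\Omega$, $(\hat R,\hat\Omega)$ satisfies the Lagrange--d'Alembert principle with dissipation term $D(\Omega^m-\hat\Omega)$, $\hat R(t_0)=\hat R_0$, $\hat\Omega(t_0)=\hat\Omega_0$, and $\omega=\Omega^m-\hat\Omega$ on $[t_0,T]$. (ii) $\hat R$ takes values in $SO(3)$, $\hat R$ and $\omega$ are differentiable on $[t_0,T]$ (one-sidedly at the end points), and $(\hat R,\hat\Omega,\omega)$ solves the filter equations $$\begin{cases}\dot{\hat R}=\hat R\,(\Omega^m-\omega)^\times,\\ m\dot\omega=-m\,\hat\Omega\times\omega+\Phi'\big(\mathcal U^0(\hat R,U^m)\big)S_L(\hat R)-D\omega,\\ \hat\Omega=\Omega^m-\omega,\end{cases}$$ on $[t_0,T]$ with $\hat R(t_0)=\hat R_0$ and $\omega(t_0)=\omega_0=\Omega^m(t_0)-\hat\Omega_0$,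 where $S_L(\hat R)=\mathrm{vex}(L^{T}\hat R-\hat R^{T}L)$ and $L=EW(U^m)^{T}$. -/

import Mathlib

open Set Matrix

namespace AttitudeFilter

/-- Vectors of `ℝ³`, with the dot product `⬝ᵥ` and the cross product `⨯₃` of Mathlib. -/
abbrev Vec3 : Type := Fin 3 → ℝ

/-- Real `3 × 3` matrices. -/
abbrev Mat3 : Type := Matrix (Fin 3) (Fin 3) ℝ

/-- The rotation group `SO(3)`, as a set of matrices. -/
def SO3 : Set Mat3 := {R | R ∈ Matrix.specialOrthogonalGroup (Fin 3) ℝ}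

/-- The cross-product matrix `v^×` of a vector `v ∈ ℝ³`. -/
def hat (v : Vec3) : Mat3 :=
  !![0, -v 2, v 1;
     v 2, 0, -v 0;
     -v 1, v 0, 0]

/-- `vex : so(3) → ℝ³`, the inverse of `v ↦ v^×` (on matrices that are not skew-symmetric the
value is irrelevant). -/
def vex (A : Mat3) : Vec3 := ![A 2 1, A 0 2, A 1 0]

theorem hat_mulVec (v w : Vec3) : hat v *ᵥ w = v ⨯₃ w := by
  ext i
  fin_cases i <;>
    simp [hat, Matrix.mulVec, dotProduct, Fin.sum_univ_three, cross_apply] <;> ring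

theorem vex_hat (v : Vec3) : vex (hat v) = v := by
  ext i
  fin_cases i <;> simp [hat, vex]

theorem hat_vex (A : Mat3) (hA : Aᵀ = -A) : hat (vex A) = A := by
  have h : ∀ i j, A j i = -A i j := fun i j => by
    have := congrFun (congrFun hA i) j
    simpa [Matrix.transpose_apply] using this
  have h0 : ∀ i, A i i = 0 := fun i => by linarith [h i i]
  ext i j
  fin_cases i <;> fin_cases j <;> simp [hat, vex, h0]
  all_goals first | linarith [h 1 0] | linarith [h 2 0] | linarith [h 2 1]

/-- The trace inner product `⟨A, B⟩ = trace (Aᵀ B)`. -/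
def traceInner {a b : Type*} [Fintype a] [Fintype b] (A B : Matrix a b ℝ) : ℝ :=
  (Aᵀ * B).trace

/-- Wahba's cost `U⁰(R, U) = ½ ⟨E - R U, (E - R U) W⟩`. -/
noncomputable def wahbaCost {n : ℕ} (E : Matrix (Fin 3) (Fin n) ℝ)
    (W : Matrix (Fin n) (Fin n) ℝ) (R : Mat3) (U : Matrix (Fin 3) (Fin n) ℝ) : ℝ :=
  (1 / 2) * traceInner (E - R * U) ((E - R * U) * W)

/-- The derivative `Φ'` of a function on `[0, ∞)` (one-sided at `0`). -/
noncomputable def derivHalfLine (Φ : ℝ → ℝ) (x : ℝ) : ℝ := derivWithin Φ (Ici 0) x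

/-- `Φ : [0, ∞) → [0, ∞)` is `C²`, with `Φ(0) = 0` and `Φ' > 0` on `[0, ∞)`.
Values of `Φ` at negative numbers play no role. -/
structure IsCostShape (Φ : ℝ → ℝ) : Prop where
  nonneg : ∀ x ∈ Ici (0 : ℝ), 0 ≤ Φ x
  contDiffOn : ContDiffOn ℝ 2 Φ (Ici 0)
  zero : Φ 0 = 0
  deriv_pos : ∀ x ∈ Ici (0 : ℝ), 0 < derivHalfLine Φ x

/-- The energy `(m/2) (Ωᵐ - Ω)ᵀ (Ωᵐ - Ω)` of the angular velocity estimation error. -/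
noncomputable def kineticTerm (m : ℝ) (Ω Ωm : Vec3) : ℝ :=
  m / 2 * ((Ωm - Ω) ⬝ᵥ (Ωm - Ω))

/-- The Lagrangian `(m/2) |Ωᵐ - Ω|² - Φ(U⁰(R, Uᵐ))`. -/
noncomputable def lagrangian {n : ℕ} (m : ℝ) (Φ : ℝ → ℝ) (E : Matrix (Fin 3) (Fin n) ℝ)
    (W : Matrix (Fin n) (Fin n) ℝ) (R : Mat3) (Um : Matrix (Fin 3) (Fin n) ℝ)
    (Ω Ωm : Vec3) : ℝ :=
  kineticTerm m Ω Ωm - Φ (wahbaCost E W R Um)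

/-- The action of the curve `(R, Ω)` over `[t₀, T]`, for measurements `Uᵐ(t)`, `Ωᵐ(t)`. -/
noncomputable def action {n : ℕ} (m : ℝ) (Φ : ℝ → ℝ) (E : Matrix (Fin 3) (Fin n) ℝ)
    (W : Matrix (Fin n) (Fin n) ℝ) (t₀ T : ℝ) (Um : ℝ → Matrix (Fin 3) (Fin n) ℝ)
    (Ωm : ℝ → Vec3) (R : ℝ → Mat3) (Ω : ℝ → Vec3) : ℝ :=
  ∫ s in t₀..T, lagrangian m Φ E W (R s) (Um s) (Ω s) (Ωm s)

/-- `R` is a `C¹` curve in `SO(3)` over `[t₀, T]` and `Ω` is its body angular velocity: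
`Ṙ = R Ω^×`, with `Ω` continuous. -/
structure IsTrajectory (t₀ T : ℝ) (R : ℝ → Mat3) (Ω : ℝ → Vec3) : Prop where
  mem : ∀ t ∈ Icc t₀ T, R t ∈ SO3
  kinematics : ∀ t ∈ Icc t₀ T, HasDerivWithinAt R (R t * hat (Ω t)) (Icc t₀ T) t
  continuousOn : ContinuousOn Ω (Icc t₀ T)

/-- `(R_ε, Ω_ε)`, for `ε ∈ (-δ, δ)`, is a variation with fixed end points of the curve `Rhat` in
`SO(3)`: every `R_ε` is a curve in `SO(3)` with angular velocity `Ω_ε`, the family passes through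
`Rhat` at `ε = 0`, the end points do not move, and `R_ε(t)`, `Ω_ε(t)` are `C¹` in `ε` with
derivatives that are continuous in `(ε, t)`. The curve `Sig` in `ℝ³` is its variation vector, given
by `∂R_ε/∂ε = Rhat Sig^×` at `ε = 0`. -/
structure IsVariation (t₀ T : ℝ) (Rhat : ℝ → Mat3) (δ : ℝ) (R : ℝ → ℝ → Mat3)
    (Ω : ℝ → ℝ → Vec3) (Sig : ℝ → Vec3) : Prop where
  pos : 0 < δ
  base : ∀ t ∈ Icc t₀ T, R 0 t = Rhat t
  trajectory : ∀ ε ∈ Ioo (-δ) δ, IsTrajectory t₀ T (R ε) (Ω ε)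
  left : ∀ ε ∈ Ioo (-δ) δ, R ε t₀ = Rhat t₀
  right : ∀ ε ∈ Ioo (-δ) δ, R ε T = Rhat T
  differentiable_R : ∀ ε ∈ Ioo (-δ) δ, ∀ t ∈ Icc t₀ T,
    DifferentiableAt ℝ (fun ε' => R ε' t) ε
  differentiable_Ω : ∀ ε ∈ Ioo (-δ) δ, ∀ t ∈ Icc t₀ T,
    DifferentiableAt ℝ (fun ε' => Ω ε' t) ε
  continuous_R : ContinuousOn (fun p : ℝ × ℝ => deriv (fun ε' => R ε' p.2) p.1)
    (Ioo (-δ) δ ×ˢ Icc t₀ T)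
  continuous_Ω : ContinuousOn (fun p : ℝ × ℝ => deriv (fun ε' => Ω ε' p.2) p.1)
    (Ioo (-δ) δ ×ˢ Icc t₀ T)
  vector : ∀ t ∈ Icc t₀ T, HasDerivAt (fun ε => R ε t) (Rhat t * hat (Sig t)) 0

/-- The Lagrange-d'Alembert principle on `[t₀, T]` with dissipation `τ = D (Ωᵐ - Ωhat)`:
`Rhat` is a curve in `SO(3)` with angular velocity `Ωhat`, and for every variation with fixed end
points the first variation `δS` of the action exists and satisfies `δS + ∫ τᵀ Sig dt = 0`. -/
structure LagrangeDAlembert {n : ℕ} (m : ℝ) (Φ : ℝ → ℝ) (E : Matrix (Fin 3) (Fin n) ℝ)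
    (W : Matrix (Fin n) (Fin n) ℝ) (D : Mat3) (t₀ T : ℝ)
    (Um : ℝ → Matrix (Fin 3) (Fin n) ℝ) (Ωm : ℝ → Vec3)
    (Rhat : ℝ → Mat3) (Ωhat : ℝ → Vec3) : Prop where
  trajectory : IsTrajectory t₀ T Rhat Ωhat
  stationary : ∀ (δ : ℝ) (R : ℝ → ℝ → Mat3) (Ω : ℝ → ℝ → Vec3) (Sig : ℝ → Vec3),
    IsVariation t₀ T Rhat δ R Ω Sig →
      ∃ δS : ℝ,
        HasDerivAt (fun ε => action m Φ E W t₀ T Um Ωm (R ε) (Ω ε)) δS 0 ∧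
        δS + ∫ t in t₀..T, (D *ᵥ (Ωm t - Ωhat t)) ⬝ᵥ Sig t = 0

/-- `S_L(R) = vex (Lᵀ R - Rᵀ L)`. -/
def SL (L R : Mat3) : Vec3 := vex (Lᵀ * R - Rᵀ * L)

/-- The filter equations on `[t₀, T]`, with initial values `R₀` of `Rhat` and `ω₀` of `ω`. -/
structure IsFilter {n : ℕ} (m : ℝ) (Φ : ℝ → ℝ) (E : Matrix (Fin 3) (Fin n) ℝ)
    (W : Matrix (Fin n) (Fin n) ℝ) (D : Mat3) (t₀ T : ℝ)
    (Um : ℝ → Matrix (Fin 3) (Fin n) ℝ) (Ωm : ℝ → Vec3) (R₀ : Mat3) (ω₀ : Vec3)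
    (Rhat : ℝ → Mat3) (Ωhat ω : ℝ → Vec3) : Prop where
  mem : ∀ t ∈ Icc t₀ T, Rhat t ∈ SO3
  attitude : ∀ t ∈ Icc t₀ T,
    HasDerivWithinAt Rhat (Rhat t * hat (Ωm t - ω t)) (Icc t₀ T) t
  velocity : ∀ t ∈ Icc t₀ T,
    DifferentiableWithinAt ℝ ω (Icc t₀ T) t ∧
    m • derivWithin ω (Icc t₀ T) t =
      -(m • (Ωhat t ⨯₃ ω t))
        + derivHalfLine Φ (wahbaCost E W (Rhat t) (Um t)) • SL (E * W * (Um t)ᵀ) (Rhat t)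
        - D *ᵥ ω t
  estimate : ∀ t ∈ Icc t₀ T, Ωhat t = Ωm t - ω t
  init_attitude : Rhat t₀ = R₀
  init_velocity : ω t₀ = ω₀

end AttitudeFilter

/-! Write ω = Ωᵐ - Ω̂ and let F = -m Ω̂ × ω + Φ' S_L - Dω be the right hand side of the filter
equation. Along a variation with vector Σ, the first variation of the action is -∫ (m ω·δΩ + Φ'
S_L·Σ). Interchanging the derivatives in ε and t gives δΩ = Σ̇ + Ω̂ × Σ. Since ω·(Ω̂ × Σ) = -(Ω̂ ×
ω)·Σ, the quantity in the principle becomes -∫ (F·Σ + m ω·Σ̇)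
(`IsVariation.exists_hasDerivAt_action_add`).

If m ω̇ = F, this integrand is the derivative of m ω·Σ, and the boundary terms vanish because Σ is
zero at fixed end points. Conversely, rotating R̂ about the i-th body axis by the angle ε φ(t) gives
Σ = φ eᵢ and Σ̇ = φ' eᵢ, with φ an arbitrary C¹ function vanishing at the ends. The principle then
reads ∫ (F_i φ + m ω_i φ') = 0, and the lemma of du Bois-Reymond yields m ω̇_i = F_i.

Regularity is the delicate point. Neither Ωᵐ nor Ω̂ is assumed differentiable, so the
differentiability of their difference ω has to come out of the du Bois-Reymond argument; and ∂_t ∂_ε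
R is not assumed to exist, so mixed derivatives are exchanged through an integral identity. -/

namespace AttitudeFilter

open Filter Topology MeasureTheory intervalIntegral

/-! ### Calculus on a closed interval: primitives, parameter integrals, du Bois-Reymond. -/

section RealAnalysis

theorem hasDerivWithinAt_integral_Icc {a b : ℝ} (hab : a ≤ b) {f : ℝ → ℝ}
    (hf : ContinuousOn f (Icc a b)) {t : ℝ} (ht : t ∈ Icc a b) :
    HasDerivWithinAt (fun u => ∫ s in a..u, f s) (f t) (Icc a b) t := by
  -- Constant extension past the end points makes the integrand continuous on the whole line, so the
  -- two-sided fundamental theorem applies and is then restricted.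
  set F : ℝ → ℝ := fun x => f (projIcc a b hab x)
  have hF : Continuous F := hf.domRestrict.comp continuous_projIcc
  have hFf : ∀ x ∈ Icc a b, F x = f x := fun x hx => by simp [F, projIcc_of_mem hab hx]
  have h := (integral_hasDerivAt_right (hF.intervalIntegrable a t)
    hF.stronglyMeasurable.stronglyMeasurableAtFilter hF.continuousAt).hasDerivWithinAt
      (s := Icc a b)
  rw [hFf t ht] at h
  refine h.congr_of_mem (fun u hu => ?_) ht
  refine integral_congr fun s hs => (hFf s ?_).symm
  rw [uIcc_of_le hu.1] at hs
  exact ⟨hs.1, hs.2.trans hu.2⟩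

theorem integral_eq_sub_of_hasDerivWithinAt_Icc {a b : ℝ} (hab : a ≤ b) {f f' : ℝ → ℝ}
    (hf : ∀ t ∈ Icc a b, HasDerivWithinAt f (f' t) (Icc a b) t)
    (hf' : ContinuousOn f' (Icc a b)) : ∫ t in a..b, f' t = f b - f a :=
  integral_eq_sub_of_hasDerivAt_of_le hab (fun t ht => (hf t ht).continuousWithinAt)
    (fun t ht => (hf t (Ioo_subset_Icc_self ht)).hasDerivAt (Icc_mem_nhds ht.1 ht.2))
    (hf'.intervalIntegrable_of_Icc hab)

variable {δ a b : ℝ} {g g' : ℝ → ℝ → ℝ}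

/-- On a compact neighbourhood the ε-derivative is bounded, so `g` is Lipschitz in ε uniformly in
`t`; continuity in `t` on the single slice through the point then suffices for joint continuity. -/
theorem continuousOn_uncurry_of_hasDerivAt
    (hd : ∀ ε ∈ Ioo (-δ) δ, ∀ t ∈ Icc a b, HasDerivAt (fun e => g e t) (g' ε t) ε)
    (hc : ContinuousOn (fun p : ℝ × ℝ => g' p.1 p.2) (Ioo (-δ) δ ×ˢ Icc a b))
    (h0 : ∀ ε ∈ Ioo (-δ) δ, ContinuousOn (g ε) (Icc a b)) :
    ContinuousOn (fun p : ℝ × ℝ => g p.1 p.2) (Ioo (-δ) δ ×ˢ Icc a b) := by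
  rintro ⟨e, t⟩ ⟨he, ht⟩
  obtain ⟨r, hr, hrs⟩ := Metric.isOpen_iff.1 isOpen_Ioo e he
  have hsub : Metric.closedBall e (r / 2) ⊆ Ioo (-δ) δ :=
    (Metric.closedBall_subset_ball (by linarith)).trans hrs
  obtain ⟨C, hC⟩ := ((isCompact_closedBall e (r / 2)).prod (isCompact_Icc (a := a) (b := b))
    ).exists_bound_of_continuousOn (hc.mono (prod_mono hsub subset_rfl))
  have hbound : ∀ x ∈ Metric.closedBall e (r / 2), ∀ s ∈ Icc a b,
      ‖g x s - g e s‖ ≤ C * ‖x - e‖ := fun x hx s hs =>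
    (convex_closedBall e (r / 2)).norm_image_sub_le_of_norm_hasDerivWithin_le
      (f := fun y => g y s) (f' := fun y => g' y s)
      (fun y hy => (hd y (hsub hy) s hs).hasDerivWithinAt)
      (fun y hy => hC (y, s) ⟨hy, hs⟩) (Metric.mem_closedBall_self (by linarith)) hx
  have h1 : Tendsto (fun p : ℝ × ℝ => g p.1 p.2 - g e p.2)
      (𝓝[Ioo (-δ) δ ×ˢ Icc a b] (e, t)) (𝓝 0) := by
    refine squeeze_zero_norm' (a := fun p => C * ‖p.1 - e‖) ?_ ?_
    · have hm : ∀ᶠ p : ℝ × ℝ in 𝓝[Ioo (-δ) δ ×ˢ Icc a b] (e, t),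
          p.1 ∈ Metric.closedBall e (r / 2) :=
        nhdsWithin_le_nhds (continuous_fst.continuousAt.eventually
          (Metric.closedBall_mem_nhds e (by linarith)))
      filter_upwards [hm, self_mem_nhdsWithin] with p hp hq
      exact hbound p.1 hp p.2 hq.2
    · have : Continuous fun p : ℝ × ℝ => C * ‖p.1 - e‖ := by fun_prop
      simpa using (this.tendsto (e, t)).mono_left nhdsWithin_le_nhds
  have h2 : Tendsto (fun p : ℝ × ℝ => g e p.2)
      (𝓝[Ioo (-δ) δ ×ˢ Icc a b] (e, t)) (𝓝 (g e t)) :=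
    ((h0 e he).comp continuousOn_snd fun p hp => hp.2) (e, t) ⟨he, ht⟩
  simpa [ContinuousWithinAt] using h1.add h2

theorem hasDerivAt_integral_of_continuousOn (hδ : 0 < δ) (hab : a ≤ b)
    (hd : ∀ ε ∈ Ioo (-δ) δ, ∀ t ∈ Icc a b, HasDerivAt (fun e => g e t) (g' ε t) ε)
    (hc : ContinuousOn (fun p : ℝ × ℝ => g' p.1 p.2) (Ioo (-δ) δ ×ˢ Icc a b))
    (h0 : ∀ ε ∈ Ioo (-δ) δ, ContinuousOn (g ε) (Icc a b)) :
    HasDerivAt (fun e => ∫ t in a..b, g e t) (∫ t in a..b, g' 0 t) 0 := by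
  -- Halving the radius gives a compact parameter set, on which continuity of `g'` provides a
  -- constant dominating function.
  have hsub : Metric.closedBall (0 : ℝ) (δ / 2) ⊆ Ioo (-δ) δ := by
    rw [Real.closedBall_eq_Icc]
    exact Icc_subset_Ioo (by linarith) (by linarith)
  have h0δ : (0 : ℝ) ∈ Ioo (-δ) δ := ⟨by linarith, hδ⟩
  obtain ⟨C, hC⟩ := ((isCompact_closedBall (0 : ℝ) (δ / 2)).prod
    (isCompact_Icc (a := a) (b := b))).exists_bound_of_continuousOn
      (hc.mono (prod_mono hsub subset_rfl))
  have hIoc : uIoc a b ⊆ Icc a b := by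
    rw [uIoc_of_le hab]; exact Ioc_subset_Icc_self
  have hmeas : ∀ f : ℝ → ℝ, ContinuousOn f (Icc a b) →
      AEStronglyMeasurable f (volume.restrict (uIoc a b)) := fun f hf =>
    (hf.mono hIoc).aestronglyMeasurable measurableSet_uIoc
  have hc0 : ContinuousOn (g' 0) (Icc a b) :=
    hc.comp (f := fun t => ((0 : ℝ), t)) (by fun_prop) fun t ht => ⟨h0δ, ht⟩
  refine (hasDerivAt_integral_of_dominated_loc_of_deriv_le (F' := g') (bound := fun _ => C)
    (Metric.closedBall_mem_nhds (0 : ℝ) (half_pos hδ)) ?_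
    ((h0 0 h0δ).intervalIntegrable_of_Icc hab) (hmeas _ hc0) ?_ (by simp) ?_).2
  · filter_upwards [isOpen_Ioo.mem_nhds h0δ] with e he using hmeas _ (h0 e he)
  · exact Eventually.of_forall fun t ht e he => hC (e, t) ⟨he, hIoc ht⟩
  · exact Eventually.of_forall fun t ht e he => hd e (hsub he) t (hIoc ht)

/-- The lemma of du Bois-Reymond. -/
theorem hasDerivWithinAt_of_forall_integral_eq_zero {p q : ℝ → ℝ} (hab : a < b)
    (hp : ContinuousOn p (Icc a b)) (hq : ContinuousOn q (Icc a b))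
    (h : ∀ φ φ' : ℝ → ℝ, (∀ t, HasDerivAt φ (φ' t) t) → Continuous φ' → φ a = 0 → φ b = 0 →
      ∫ t in a..b, (p t * φ' t + q t * φ t) = 0) {t : ℝ} (ht : t ∈ Icc a b) :
    HasDerivWithinAt p (q t) (Icc a b) t := by
  set Q : ℝ → ℝ := fun u => ∫ s in a..u, q s with hQ_def
  have hQ : ∀ t ∈ Icc a b, HasDerivWithinAt Q (q t) (Icc a b) t := fun t ht =>
    hasDerivWithinAt_integral_Icc hab.le hq ht
  have hQc : ContinuousOn Q (Icc a b) := fun t ht => (hQ t ht).continuousWithinAt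
  -- `c` is the mean of `p - Q`, so the primitive `φ` of `p - Q - c` vanishes at both ends and is an
  -- admissible test function.
  set c : ℝ := (b - a)⁻¹ * ∫ s in a..b, (p s - Q s) with hc_def
  set f : ℝ → ℝ := fun s => p s - Q s - c with hf_def
  have hf : ContinuousOn f (Icc a b) := (hp.sub hQc).sub continuousOn_const
  set F : ℝ → ℝ := fun x => f (projIcc a b hab.le x)
  have hF : Continuous F := hf.domRestrict.comp continuous_projIcc
  have hFf : ∀ x ∈ Icc a b, F x = f x := fun x hx => by simp [F, projIcc_of_mem hab.le hx]
  have hint : ∀ {k : ℝ → ℝ}, ContinuousOn k (Icc a b) → IntervalIntegrable k volume a b :=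
    fun hk => hk.intervalIntegrable_of_Icc hab.le
  have huIcc : uIcc a b = Icc a b := uIcc_of_le hab.le
  set φ : ℝ → ℝ := fun u => ∫ s in a..u, F s with hφ_def
  have hφ : ∀ t, HasDerivAt φ (F t) t := fun t =>
    integral_hasDerivAt_right (hF.intervalIntegrable a t)
      hF.stronglyMeasurable.stronglyMeasurableAtFilter hF.continuousAt
  have hφc : Continuous φ := continuous_iff_continuousAt.2 fun t => (hφ t).continuousAt
  have hφa : φ a = 0 := by simp [φ]
  have hφb : φ b = 0 := by
    have h1 : φ b = ∫ s in a..b, f s :=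
      integral_congr fun s hs => hFf s (huIcc ▸ hs)
    have h2 : ∫ s in a..b, f s = (∫ s in a..b, (p s - Q s)) - ∫ s in a..b, c :=
      integral_sub (hint (hp.sub hQc)) (hint continuousOn_const)
    rw [h1, h2, intervalIntegral.integral_const, smul_eq_mul, hc_def, ← mul_assoc,
      mul_inv_cancel₀ (sub_pos.2 hab).ne', one_mul, sub_self]
  have hmain := h φ F hφ hF hφa hφb
  have hparts : ∫ t in a..b, (q t * φ t + Q t * F t) = 0 := by
    rw [integral_eq_sub_of_hasDerivWithinAt_Icc (f := fun t => Q t * φ t) hab.le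
      (fun t ht => (hQ t ht).mul (hφ t).hasDerivWithinAt)
      ((hq.mul hφc.continuousOn).add (hQc.mul hF.continuousOn))]
    simp [hφa, hφb]
  have hcF : ∫ t in a..b, c * F t = 0 := by
    rw [intervalIntegral.integral_const_mul]
    exact mul_eq_zero_of_right _ hφb
  -- With φ' = F = p - Q - c, one has F² = (p F + q φ) - (Q φ)' - c F, and each of the three terms
  -- integrates to zero. Hence p = Q + c.
  have hsq : ∫ t in a..b, F t ^ 2 = 0 := by
    have h1 : ∫ t in a..b, F t ^ 2 = ∫ t in a..b,
        ((p t * F t + q t * φ t) - (q t * φ t + Q t * F t) - c * F t) := by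
      refine integral_congr fun s hs => ?_
      have := hFf s (huIcc ▸ hs)
      simp only [hf_def] at this
      linear_combination F s * this
    have i1 : ContinuousOn (fun t => p t * F t + q t * φ t) (Icc a b) :=
      (hp.mul hF.continuousOn).add (hq.mul hφc.continuousOn)
    have i2 : ContinuousOn (fun t => q t * φ t + Q t * F t) (Icc a b) :=
      (hq.mul hφc.continuousOn).add (hQc.mul hF.continuousOn)
    have i3 : ContinuousOn (fun t => c * F t) (Icc a b) :=
      continuousOn_const.mul hF.continuousOn
    have h2 := integral_sub (hint (i1.sub i2)) (hint i3)
    have h3 := integral_sub (hint i1) (hint i2)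
    simp only [Pi.sub_apply] at h2
    rw [h1, h2, h3, hmain, hparts, hcF]
    simp
  have hzero : ∀ t ∈ Icc a b, p t = Q t + c := by
    intro t ht
    by_contra hne
    have hpos : 0 < ∫ t in a..b, F t ^ 2 := by
      refine integral_pos hab (hF.pow 2).continuousOn (fun s _ => sq_nonneg _) ⟨t, ht, ?_⟩
      have : F t ≠ 0 := by
        rw [hFf t ht]
        intro h0
        apply hne
        simp only [hf_def] at h0
        linarith
      positivity
    exact hpos.ne' hsq
  exact ((hQ t ht).add_const c).congr_of_mem hzero ht

end RealAnalysis

/-! ### Entrywise differentiation and continuity of matrix-valued maps. -/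

section MatrixCalculus

variable {ι κ ν : Type*}

theorem hasDerivWithinAt_matrix [Fintype κ] {R : ℝ → Matrix ι κ ℝ} {R' : Matrix ι κ ℝ} {s : Set ℝ} {t : ℝ} :
    HasDerivWithinAt R R' s t ↔
      ∀ i j, HasDerivWithinAt (fun t => R t i j) (R' i j) s t :=
  (hasDerivWithinAt_pi (φ := R) (E' := fun _ : ι => κ → ℝ)).trans
    (forall_congr' fun _ => hasDerivWithinAt_pi)

theorem hasDerivAt_matrix [Fintype κ] {R : ℝ → Matrix ι κ ℝ} {R' : Matrix ι κ ℝ} {t : ℝ} :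
    HasDerivAt R R' t ↔ ∀ i j, HasDerivAt (fun t => R t i j) (R' i j) t :=
  (hasDerivAt_pi (φ := R) (E' := fun _ : ι => κ → ℝ)).trans
    (forall_congr' fun _ => hasDerivAt_pi)

theorem hasDerivAt_matrix_deriv [Fintype ι] [Fintype κ] {R : ℝ → Matrix ι κ ℝ} {t : ℝ}
    (h : DifferentiableAt ℝ R t) : HasDerivAt R (deriv R t) t :=
  DifferentiableAt.hasDerivAt (F := ι → κ → ℝ) (f := R) h

theorem deriv_matrix [Fintype ι] [Fintype κ] {R : ℝ → Matrix ι κ ℝ} {R' : Matrix ι κ ℝ} {t : ℝ}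
    (h : HasDerivAt R R' t) : deriv R t = R' :=
  HasDerivAt.deriv (F := ι → κ → ℝ) (f := R) h

theorem differentiableAt_matrix [Fintype ι] [Fintype κ] {R : ℝ → Matrix ι κ ℝ}
    {R' : Matrix ι κ ℝ} {t : ℝ} (h : HasDerivAt R R' t) : DifferentiableAt ℝ R t :=
  HasDerivAt.differentiableAt (F := ι → κ → ℝ) (f := R) h

theorem continuousOn_matrix {X : Type*} [TopologicalSpace X] {R : X → Matrix ι κ ℝ} {s : Set X} :
    ContinuousOn R s ↔ ∀ i j, ContinuousOn (fun t => R t i j) s :=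
  (continuousOn_pi (f := R) (X := fun _ : ι => κ → ℝ)).trans
    (forall_congr' fun _ => continuousOn_pi)

theorem hasDerivWithinAt_matrix_mul [Fintype κ] [Fintype ν] {A : ℝ → Matrix ι κ ℝ} {B : ℝ → Matrix κ ν ℝ}
    {A' : Matrix ι κ ℝ} {B' : Matrix κ ν ℝ} {s : Set ℝ} {t : ℝ}
    (hA : HasDerivWithinAt A A' s t) (hB : HasDerivWithinAt B B' s t) :
    HasDerivWithinAt (fun t => A t * B t) (A' * B t + A t * B') s t := by
  rw [hasDerivWithinAt_matrix] at *
  intro i j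
  simp only [Matrix.mul_apply, Matrix.add_apply, ← Finset.sum_add_distrib]
  exact HasDerivWithinAt.fun_sum fun k _ => (hA i k).mul (hB k j)

theorem hasDerivAt_matrix_mul [Fintype κ] [Fintype ν] {A : ℝ → Matrix ι κ ℝ} {B : ℝ → Matrix κ ν ℝ}
    {A' : Matrix ι κ ℝ} {B' : Matrix κ ν ℝ} {t : ℝ}
    (hA : HasDerivAt A A' t) (hB : HasDerivAt B B' t) :
    HasDerivAt (fun t => A t * B t) (A' * B t + A t * B') t := by
  rw [hasDerivAt_matrix] at *
  intro i j
  simp only [Matrix.mul_apply, Matrix.add_apply, ← Finset.sum_add_distrib]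
  exact HasDerivAt.fun_sum fun k _ => (hA i k).mul (hB k j)

theorem hasDerivWithinAt_transpose [Fintype ι] [Fintype κ] {A : ℝ → Matrix ι κ ℝ} {A' : Matrix ι κ ℝ} {s : Set ℝ} {t : ℝ}
    (hA : HasDerivWithinAt A A' s t) : HasDerivWithinAt (fun t => (A t)ᵀ) A'ᵀ s t := by
  rw [hasDerivWithinAt_matrix] at *
  exact fun i j => hA j i

theorem hasDerivAt_traceInner [Fintype ι] [Fintype κ] {A B : ℝ → Matrix ι κ ℝ} {A' B' : Matrix ι κ ℝ} {t : ℝ}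
    (hA : HasDerivAt A A' t) (hB : HasDerivAt B B' t) :
    HasDerivAt (fun t => traceInner (A t) (B t))
      (traceInner A' (B t) + traceInner (A t) B') t := by
  rw [hasDerivAt_matrix] at hA hB
  simp only [traceInner, Matrix.trace, Matrix.diag, Matrix.mul_apply, Matrix.transpose_apply,
    ← Finset.sum_add_distrib]
  exact HasDerivAt.fun_sum fun i _ => HasDerivAt.fun_sum fun k _ => (hA k i).mul (hB k i)

theorem continuous_traceInner [Fintype ι] [Fintype κ] :
    Continuous fun p : Matrix ι κ ℝ × Matrix ι κ ℝ => traceInner p.1 p.2 :=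
  ((continuous_fst.matrix_transpose).matrix_mul continuous_snd).matrix_trace

theorem continuous_hat : Continuous hat := by
  refine continuous_matrix fun i j => ?_
  fin_cases i <;> fin_cases j <;> simp [hat] <;> fun_prop

theorem continuous_vex : Continuous vex := by
  refine continuous_pi fun i => ?_
  fin_cases i <;> simp [vex] <;> fun_prop

end MatrixCalculus

/-! ### Identities for the cross-product matrix and for `SO3`. -/

section Algebra

theorem hat_add (v w : Vec3) : hat (v + w) = hat v + hat w := by
  ext i j
  fin_cases i <;> fin_cases j <;> simp [hat] <;> ring

theorem hat_sub (v w : Vec3) : hat (v - w) = hat v - hat w := by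
  ext i j
  fin_cases i <;> fin_cases j <;> simp [hat] <;> ring

theorem hat_smul (c : ℝ) (v : Vec3) : hat (c • v) = c • hat v := by
  ext i j
  fin_cases i <;> fin_cases j <;> simp [hat]

theorem transpose_hat (v : Vec3) : (hat v)ᵀ = -hat v := by
  ext i j
  fin_cases i <;> fin_cases j <;> simp [hat]

theorem hat_cross (v w : Vec3) : hat (v ⨯₃ w) = hat v * hat w - hat w * hat v := by
  ext i j
  fin_cases i <;> fin_cases j <;>
    simp [hat, cross_apply] <;> ring

theorem hat_injective : Function.Injective hat := Function.LeftInverse.injective vex_hat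

/-- Paired with vectors x and y, both sides are the triple product det[Mx, Mv, My] = det M · det[x,
v, y]. For rotations this is the equivariance of the cross product. -/
theorem transpose_mul_hat_mulVec_mul (M : Mat3) (v : Vec3) :
    Mᵀ * hat (M *ᵥ v) * M = M.det • hat v := by
  ext i j
  fin_cases i <;> fin_cases j <;>
    simp [hat, Matrix.mul_apply, Fin.sum_univ_three, Matrix.mulVec, dotProduct,
      Matrix.det_fin_three] <;> ring

theorem mem_SO3_iff {R : Mat3} : R ∈ SO3 ↔ Rᵀ * R = 1 ∧ R.det = 1 := by
  simp only [SO3, mem_ofPred_eq, Matrix.mem_specialOrthogonalGroup_iff,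
    Matrix.mem_orthogonalGroup_iff']

theorem hat_transpose_mulVec {A : Mat3} (hA : A ∈ SO3) (v : Vec3) :
    hat (Aᵀ *ᵥ v) = Aᵀ * hat v * A := by
  obtain ⟨h1, h2⟩ := mem_SO3_iff.1 hA
  have h := transpose_mul_hat_mulVec_mul A (Aᵀ *ᵥ v)
  rw [Matrix.mulVec_mulVec, mul_eq_one_comm.1 h1, Matrix.one_mulVec, h2, one_smul] at h
  exact h.symm

theorem mul_mem_SO3 {A B : Mat3} (hA : A ∈ SO3) (hB : B ∈ SO3) : A * B ∈ SO3 :=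
  (Matrix.specialOrthogonalGroup (Fin 3) ℝ).mul_mem hA hB

theorem traceInner_hat (v : Vec3) (M : Mat3) : traceInner (hat v) M = v ⬝ᵥ vex (M - Mᵀ) := by
  simp [traceInner, Matrix.trace, hat, vex, Matrix.mul_apply, Fin.sum_univ_three, dotProduct]
  ring

/-- This identifies the gradient of Wahba's cost. As RᵀR = 1, the pairing equals ⟨v^×, RᵀL - U W Uᵀ⟩
with L = E W Uᵀ. A skew matrix sees only the skew part, so the symmetric U W Uᵀ drops out. -/
theorem traceInner_mul_hat_mul {n : ℕ} {W : Matrix (Fin n) (Fin n) ℝ} (hW : Wᵀ = W)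
    (E U : Matrix (Fin 3) (Fin n) ℝ) {R : Mat3} (hR : R ∈ SO3) (v : Vec3) :
    traceInner (R * hat v * U) ((E - R * U) * W) = -(SL (E * W * Uᵀ) R ⬝ᵥ v) := by
  have key : traceInner (R * hat v * U) ((E - R * U) * W) =
      traceInner (hat v) (Rᵀ * (E * W * Uᵀ) - U * W * Uᵀ) := by
    have h : Rᵀ * (E * W * Uᵀ) - U * W * Uᵀ = Rᵀ * ((E - R * U) * W) * Uᵀ := by
      simp only [Matrix.sub_mul, Matrix.mul_sub, Matrix.mul_assoc]
      rw [← Matrix.mul_assoc Rᵀ R, (mem_SO3_iff.1 hR).1, Matrix.one_mul]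
    rw [h, traceInner, traceInner, Matrix.transpose_mul, Matrix.transpose_mul, Matrix.mul_assoc,
      Matrix.trace_mul_comm]
    simp only [Matrix.mul_assoc]
  have hsub : Rᵀ * (E * W * Uᵀ) - U * W * Uᵀ - (Rᵀ * (E * W * Uᵀ) - U * W * Uᵀ)ᵀ =
      -((E * W * Uᵀ)ᵀ * R - Rᵀ * (E * W * Uᵀ)) := by
    simp only [Matrix.transpose_sub, Matrix.transpose_mul, Matrix.transpose_transpose, hW,
      Matrix.mul_assoc]
    abel
  have hneg : ∀ A : Mat3, vex (-A) = -vex A := fun A => by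
    ext i; fin_cases i <;> simp [vex]
  rw [key, traceInner_hat, hsub, hneg, dotProduct_neg, dotProduct_comm]
  rfl

end Algebra

/-! ### Differentiating through `hat`. -/

section Hat

theorem hasDerivAt_hat {v : ℝ → Vec3} {v' : Vec3} {t : ℝ} (hv : HasDerivAt v v' t) :
    HasDerivAt (fun s => hat (v s)) (hat v') t := by
  have h := hasDerivAt_pi.1 hv
  have h0 := hasDerivAt_const t (0 : ℝ)
  refine hasDerivAt_matrix.2 fun i j => ?_
  fin_cases i <;> fin_cases j
  exacts [h0, (h 2).neg, h 1, h 2, h0, (h 0).neg, (h 1).neg, h 0, h0]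

theorem hasDerivWithinAt_of_hat {v : ℝ → Vec3} {v' : Vec3} {s : Set ℝ} {t : ℝ}
    (hv : HasDerivWithinAt (fun s => hat (v s)) (hat v') s t) : HasDerivWithinAt v v' s t := by
  have h := hasDerivWithinAt_matrix.1 hv
  refine hasDerivWithinAt_pi.2 fun i => ?_
  fin_cases i
  exacts [h 2 1, h 0 2, h 1 0]

theorem continuousOn_mul_hat {X : Type*} [TopologicalSpace X] {A : X → Mat3} {v : X → Vec3}
    {s : Set X} (hA : ContinuousOn A s) (hv : ContinuousOn v s) :
    ContinuousOn (fun p => A p * hat (v p)) s :=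
  (continuous_fst.matrix_mul (continuous_hat.comp continuous_snd)).comp_continuousOn
    (hA.prodMk hv)

end Hat

/-! ### Kinematics of variations. -/

section Variation

variable {t₀ T δ : ℝ} {Rhat : ℝ → Mat3} {Ωhat : ℝ → Vec3} {R : ℝ → ℝ → Mat3}
  {Ω : ℝ → ℝ → Vec3} {Sig : ℝ → Vec3}

theorem IsTrajectory.continuousOn_attitude (h : IsTrajectory t₀ T Rhat Ωhat) :
    ContinuousOn Rhat (Icc t₀ T) :=
  continuousOn_matrix.2 fun i j t ht =>
    (hasDerivWithinAt_matrix.1 (h.kinematics t ht) i j).continuousWithinAt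

theorem IsVariation.zero_mem (hV : IsVariation t₀ T Rhat δ R Ω Sig) : (0 : ℝ) ∈ Ioo (-δ) δ :=
  ⟨neg_lt_zero.2 hV.pos, hV.pos⟩

theorem IsVariation.hasDerivAt_attitude (hV : IsVariation t₀ T Rhat δ R Ω Sig) {ε : ℝ}
    (hε : ε ∈ Ioo (-δ) δ) {t : ℝ} (ht : t ∈ Icc t₀ T) :
    HasDerivAt (fun e => R e t) (deriv (fun e => R e t) ε) ε :=
  hasDerivAt_matrix_deriv (hV.differentiable_R ε hε t ht)

theorem IsVariation.hasDerivAt_velocity (hV : IsVariation t₀ T Rhat δ R Ω Sig) {ε : ℝ}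
    (hε : ε ∈ Ioo (-δ) δ) {t : ℝ} (ht : t ∈ Icc t₀ T) :
    HasDerivAt (fun e => Ω e t) (deriv (fun e => Ω e t) ε) ε :=
  (hV.differentiable_Ω ε hε t ht).hasDerivAt

theorem IsVariation.continuousOn_attitude (hV : IsVariation t₀ T Rhat δ R Ω Sig) :
    ContinuousOn (fun p : ℝ × ℝ => R p.1 p.2) (Ioo (-δ) δ ×ˢ Icc t₀ T) :=
  continuousOn_matrix.2 fun i j =>
    continuousOn_uncurry_of_hasDerivAt (g := fun e t => R e t i j)
      (fun _ hε _ ht => hasDerivAt_matrix.1 (hV.hasDerivAt_attitude hε ht) i j)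
      (continuousOn_matrix.1 hV.continuous_R i j)
      fun ε hε => continuousOn_matrix.1 (hV.trajectory ε hε).continuousOn_attitude i j

theorem IsVariation.continuousOn_velocity (hV : IsVariation t₀ T Rhat δ R Ω Sig) :
    ContinuousOn (fun p : ℝ × ℝ => Ω p.1 p.2) (Ioo (-δ) δ ×ˢ Icc t₀ T) :=
  continuousOn_pi.2 fun i =>
    continuousOn_uncurry_of_hasDerivAt (g := fun e t => Ω e t i)
      (fun _ hε _ ht => hasDerivAt_pi.1 (hV.hasDerivAt_velocity hε ht) i)
      (continuousOn_pi.1 hV.continuous_Ω i)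
      fun ε hε => continuousOn_pi.1 (hV.trajectory ε hε).continuousOn i

/-- A variation prescribes only its attitude at ε = 0. The angular velocity there is forced, because
derivatives on a nondegenerate interval are unique and `Rhat t` is invertible. -/
theorem IsVariation.velocity_base (hT : t₀ < T) (hR : IsTrajectory t₀ T Rhat Ωhat)
    (hV : IsVariation t₀ T Rhat δ R Ω Sig) {t : ℝ} (ht : t ∈ Icc t₀ T) : Ω 0 t = Ωhat t := by
  have h1 := (hV.trajectory 0 hV.zero_mem).kinematics t ht
  have h2 : Rhat t * hat (Ω 0 t) = Rhat t * hat (Ωhat t) := by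
    ext i j
    rw [← hV.base t ht]
    refine (uniqueDiffOn_Icc hT t ht).eq_deriv _ (hasDerivWithinAt_matrix.1 h1 i j) ?_
    rw [hV.base t ht]
    exact (hasDerivWithinAt_matrix.1 (hR.kinematics t ht) i j).congr_of_mem
      (fun s hs => by rw [hV.base s hs]) ht
  have h3 := (mem_SO3_iff.1 (hR.mem t ht)).1
  have h4 := congrArg (fun M => (Rhat t)ᵀ * M) h2
  simp only [← Matrix.mul_assoc, h3, Matrix.one_mul] at h4
  exact hat_injective h4

theorem IsVariation.deriv_attitude_zero (hV : IsVariation t₀ T Rhat δ R Ω Sig) {t : ℝ}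
    (ht : t ∈ Icc t₀ T) : deriv (fun e => R e t) 0 = Rhat t * hat (Sig t) := by
  ext i j
  exact (hasDerivAt_matrix.1 (hV.hasDerivAt_attitude hV.zero_mem ht) i j).unique
    (hasDerivAt_matrix.1 (hV.vector t ht) i j)

theorem IsTrajectory.transpose_mul_cancel (hR : IsTrajectory t₀ T Rhat Ωhat) {t : ℝ}
    (ht : t ∈ Icc t₀ T) (A : Mat3) : (Rhat t)ᵀ * (Rhat t * A) = A := by
  rw [← Matrix.mul_assoc, (mem_SO3_iff.1 (hR.mem t ht)).1, Matrix.one_mul]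

theorem IsVariation.vector_eq_zero (hV : IsVariation t₀ T Rhat δ R Ω Sig)
    (hR : IsTrajectory t₀ T Rhat Ωhat) {t : ℝ} (ht : t ∈ Icc t₀ T)
    (hfix : ∀ ε ∈ Ioo (-δ) δ, R ε t = Rhat t) : Sig t = 0 := by
  have h0 : Rhat t * hat (Sig t) = 0 := by
    ext i j
    refine (hasDerivAt_matrix.1 (hV.vector t ht) i j).unique ?_
    refine (hasDerivAt_const (0 : ℝ) (Rhat t i j)).congr_of_eventuallyEq ?_
    filter_upwards [isOpen_Ioo.mem_nhds hV.zero_mem] with ε hε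
    rw [hfix ε hε]
  have h1 := hR.transpose_mul_cancel ht (hat (Sig t))
  rw [h0, Matrix.mul_zero] at h1
  rw [← vex_hat (Sig t), ← h1]
  ext i
  fin_cases i <;> simp [vex]

theorem IsVariation.continuousOn_deriv_velocity (hV : IsVariation t₀ T Rhat δ R Ω Sig) :
    ContinuousOn (fun t => deriv (fun e => Ω e t) 0) (Icc t₀ T) :=
  hV.continuous_Ω.comp (f := fun t => ((0 : ℝ), t)) (by fun_prop) fun _ ht => ⟨hV.zero_mem, ht⟩

/-- Exchange of ∂_t and ∂_ε at ε = 0. The identity R_ε(s) = R̂(t₀) + ∫ R_ε Ω_ε^× is differentiated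
in ε under the integral; the resulting integrand is continuous in time, so ∂_ε R = R̂ Σ^× is a
primitive of it. -/
theorem IsVariation.hasDerivWithinAt_mul_hat_vector (hT : t₀ < T)
    (hV : IsVariation t₀ T Rhat δ R Ω Sig) {t : ℝ} (ht : t ∈ Icc t₀ T) :
    HasDerivWithinAt (fun s => Rhat s * hat (Sig s))
      (deriv (fun e => R e t) 0 * hat (Ω 0 t) + R 0 t * hat (deriv (fun e => Ω e t) 0))
      (Icc t₀ T) t := by
  obtain ⟨G, hG⟩ : ∃ G : ℝ → ℝ → Mat3, G = fun e s => R e s * hat (Ω e s) := ⟨_, rfl⟩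
  obtain ⟨G', hG'⟩ : ∃ G' : ℝ → ℝ → Mat3, G' = fun e s =>
    deriv (fun e => R e s) e * hat (Ω e s) + R e s * hat (deriv (fun e => Ω e s) e) := ⟨_, rfl⟩
  have hGd : ∀ ε ∈ Ioo (-δ) δ, ∀ s ∈ Icc t₀ T, HasDerivAt (fun e => G e s) (G' ε s) ε := by
    intro ε hε s hs
    simp only [hG, hG']
    exact hasDerivAt_matrix_mul (hV.hasDerivAt_attitude hε hs)
      (hasDerivAt_hat (hV.hasDerivAt_velocity hε hs))
  have hG'c : ContinuousOn (fun p : ℝ × ℝ => G' p.1 p.2) (Ioo (-δ) δ ×ˢ Icc t₀ T) := by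
    simp only [hG']
    exact (continuousOn_mul_hat hV.continuous_R hV.continuousOn_velocity).add
      (continuousOn_mul_hat hV.continuousOn_attitude hV.continuous_Ω)
  have hGc : ∀ ε ∈ Ioo (-δ) δ, ContinuousOn (G ε) (Icc t₀ T) := fun ε hε => by
    simp only [hG]
    exact continuousOn_mul_hat (hV.trajectory ε hε).continuousOn_attitude
      (hV.trajectory ε hε).continuousOn
  have hG'0 : ContinuousOn (G' 0) (Icc t₀ T) :=
    hG'c.comp (f := fun t => ((0 : ℝ), t)) (by fun_prop) fun _ ht => ⟨hV.zero_mem, ht⟩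
  have hint : ∀ i j, ∀ s ∈ Icc t₀ T,
      (Rhat s * hat (Sig s)) i j = ∫ u in t₀..s, G' 0 u i j := by
    intro i j s hs
    have hsub : Icc t₀ s ⊆ Icc t₀ T := Icc_subset_Icc_right hs.2
    have h1 := hasDerivAt_integral_of_continuousOn (g := fun e u => G e u i j)
      (g' := fun e u => G' e u i j) hV.pos hs.1
      (fun ε hε u hu => hasDerivAt_matrix.1 (hGd ε hε u (hsub hu)) i j)
      ((continuousOn_matrix.1 hG'c i j).mono (prod_mono subset_rfl hsub))
      (fun ε hε => (continuousOn_matrix.1 (hGc ε hε) i j).mono hsub)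
    refine (hasDerivAt_matrix.1 (hV.vector s hs) i j).unique ?_
    refine (h1.const_add (Rhat t₀ i j)).congr_of_eventuallyEq ?_
    filter_upwards [isOpen_Ioo.mem_nhds hV.zero_mem] with ε hε
    rw [integral_eq_sub_of_hasDerivWithinAt_Icc (f := fun u => R ε u i j) hs.1
      (fun u hu => by
        rw [hG]
        exact (hasDerivWithinAt_matrix.1
          ((hV.trajectory ε hε).kinematics u (hsub hu)) i j).mono hsub)
      ((continuousOn_matrix.1 (hGc ε hε) i j).mono hsub), hV.left ε hε]
    ring
  refine hasDerivWithinAt_matrix.2 fun i j => ?_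
  have h := (hasDerivWithinAt_integral_Icc hT.le (continuousOn_matrix.1 hG'0 i j) ht).congr_of_mem
    (hint i j) ht
  rw [hG'] at h
  exact h

/-- `Σ̇ = δΩ - Ωhat × Σ` along a variation. -/
theorem IsVariation.hasDerivWithinAt_vector (hT : t₀ < T) (hR : IsTrajectory t₀ T Rhat Ωhat)
    (hV : IsVariation t₀ T Rhat δ R Ω Sig) {t : ℝ} (ht : t ∈ Icc t₀ T) :
    HasDerivWithinAt Sig (deriv (fun e => Ω e t) 0 - Ωhat t ⨯₃ Sig t) (Icc t₀ T) t := by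
  -- Since Σ^× = R̂ᵀ (R̂ Σ^×), the product rule applies; the commutator of Ω̂^× and Σ^× that it
  -- produces is (Ω̂ × Σ)^×.
  have hprod := hasDerivWithinAt_matrix_mul
    (hasDerivWithinAt_transpose (hR.kinematics t ht)) (hV.hasDerivWithinAt_mul_hat_vector hT ht)
  have hval : (Rhat t * hat (Ωhat t))ᵀ * (Rhat t * hat (Sig t)) + (Rhat t)ᵀ *
      (deriv (fun e => R e t) 0 * hat (Ω 0 t) + R 0 t * hat (deriv (fun e => Ω e t) 0)) =
      hat (deriv (fun e => Ω e t) 0 - Ωhat t ⨯₃ Sig t) := by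
    have ho := (mem_SO3_iff.1 (hR.mem t ht)).1
    rw [hV.deriv_attitude_zero ht, hV.velocity_base hT hR ht, hV.base t ht, hat_sub,
      hat_cross, Matrix.transpose_mul, transpose_hat, Matrix.mul_add]
    simp only [Matrix.mul_assoc]
    simp only [← Matrix.mul_assoc (Rhat t)ᵀ, ho, Matrix.one_mul]
    rw [Matrix.neg_mul]
    abel
  rw [hval] at hprod
  refine hasDerivWithinAt_of_hat (hasDerivWithinAt_matrix.2 fun i j =>
    (hasDerivWithinAt_matrix.1 hprod i j).congr_of_mem (fun s hs => ?_) ht)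
  rw [hR.transpose_mul_cancel hs]

end Variation

/-! ### Derivatives and continuity of the terms of the Lagrangian. -/

section Cost

variable {n : ℕ} {E : Matrix (Fin 3) (Fin n) ℝ} {W : Matrix (Fin n) (Fin n) ℝ} {Φ : ℝ → ℝ}

theorem transpose_eq_of_posDef (hW : W.PosDef) : Wᵀ = W := by
  have h := hW.isHermitian
  rwa [Matrix.IsHermitian, Matrix.conjTranspose_eq_transpose_of_trivial] at h

theorem wahbaCost_nonneg (hW : W.PosDef) (R : Mat3) (U : Matrix (Fin 3) (Fin n) ℝ) :
    0 ≤ wahbaCost E W R U := by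
  have h := (hW.posSemidef.mul_mul_conjTranspose_same (E - R * U)).trace_nonneg
  rw [Matrix.conjTranspose_eq_transpose_of_trivial, Matrix.trace_mul_comm] at h
  exact mul_nonneg (by norm_num) h

theorem hasDerivAt_wahbaCost (hW : Wᵀ = W) (U : Matrix (Fin 3) (Fin n) ℝ) {R : ℝ → Mat3}
    {X : Mat3} {ε : ℝ} (hR : HasDerivAt R X ε) :
    HasDerivAt (fun e => wahbaCost E W (R e) U)
      (-traceInner (X * U) ((E - R ε * U) * W)) ε := by
  have hconst : ∀ {a b : ℕ} (B : Matrix (Fin a) (Fin b) ℝ), HasDerivAt (fun _ : ℝ => B) 0 ε :=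
    fun B => hasDerivAt_matrix.2 fun i j => hasDerivAt_const ε (B i j)
  have hA : HasDerivAt (fun e => E - R e * U) (-(X * U)) ε := by
    have h := hasDerivAt_matrix_mul hR (hconst U)
    rw [hasDerivAt_matrix] at h ⊢
    intro i j
    simpa using (h i j).const_sub (E i j)
  have hAW := hasDerivAt_matrix_mul hA (hconst W)
  have h := (hasDerivAt_traceInner hA hAW).const_mul (1 / 2 : ℝ)
  refine h.congr_deriv ?_
  -- Symmetry of `W` makes the two product-rule terms equal, which absorbs the factor 1/2.
  have hsymm : ∀ A B : Matrix (Fin 3) (Fin n) ℝ,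
      traceInner A (B * W) = traceInner B (A * W) := fun A B => by
    rw [traceInner, traceInner, ← Matrix.trace_transpose, ← Matrix.mul_assoc]
    simp only [Matrix.transpose_mul, Matrix.transpose_transpose, hW]
    rw [Matrix.trace_mul_comm, Matrix.mul_assoc]
  have hneg : ∀ A B : Matrix (Fin 3) (Fin n) ℝ, traceInner (-A) B = -traceInner A B :=
    fun A B => by simp [traceInner]
  rw [Matrix.mul_zero, add_zero, hsymm (E - R ε * U), hneg]
  ring

/-- The cost is nonnegative for every matrix `R e`, so the one-sided derivative of Φ is enough even
where the cost is zero. -/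
theorem hasDerivAt_comp_wahbaCost (hW : W.PosDef) (hΦ : IsCostShape Φ)
    (U : Matrix (Fin 3) (Fin n) ℝ) {R : ℝ → Mat3} {X : Mat3} {ε : ℝ} (hR : HasDerivAt R X ε) :
    HasDerivAt (fun e => Φ (wahbaCost E W (R e) U))
      (derivHalfLine Φ (wahbaCost E W (R ε) U) *
        -traceInner (X * U) ((E - R ε * U) * W)) ε := by
  have h1 : HasDerivWithinAt Φ (derivHalfLine Φ (wahbaCost E W (R ε) U)) (Ici 0)
      (wahbaCost E W (R ε) U) :=
    ((hΦ.contDiffOn.differentiableOn (by norm_num)) _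
      (wahbaCost_nonneg hW (R ε) U)).hasDerivWithinAt
  have h2 := (hasDerivAt_wahbaCost (E := E) (transpose_eq_of_posDef hW) U hR).hasDerivWithinAt
    (s := univ)
  rw [← hasDerivWithinAt_univ]
  exact h1.comp ε h2 fun e _ => wahbaCost_nonneg hW (R e) U

theorem continuous_wahbaCost :
    Continuous fun p : Mat3 × Matrix (Fin 3) (Fin n) ℝ => wahbaCost E W p.1 p.2 := by
  have h : Continuous fun p : Mat3 × Matrix (Fin 3) (Fin n) ℝ => E - p.1 * p.2 :=
    continuous_const.sub (continuous_fst.matrix_mul continuous_snd)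
  exact continuous_const.mul
    (continuous_traceInner.comp (h.prodMk (h.matrix_mul continuous_const)))

theorem continuousOn_comp_wahbaCost (hW : W.PosDef) {f : ℝ → ℝ} (hf : ContinuousOn f (Ici 0))
    {X : Type*} [TopologicalSpace X] {R : X → Mat3} {U : X → Matrix (Fin 3) (Fin n) ℝ}
    {s : Set X} (hR : ContinuousOn R s) (hU : ContinuousOn U s) :
    ContinuousOn (fun p => f (wahbaCost E W (R p) (U p))) s := by
  have h : ContinuousOn (fun p => wahbaCost E W (R p) (U p)) s :=
    (continuous_wahbaCost (E := E) (W := W)).comp_continuousOn (f := fun p => (R p, U p))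
      (hR.prodMk hU)
  exact hf.comp h fun p _ => wahbaCost_nonneg hW (R p) (U p)

theorem IsCostShape.continuousOn_derivHalfLine (hΦ : IsCostShape Φ) :
    ContinuousOn (derivHalfLine Φ) (Ici 0) :=
  hΦ.contDiffOn.continuousOn_derivWithin (uniqueDiffOn_Ici 0) (by norm_num)

theorem continuousOn_dotProduct {X : Type*} [TopologicalSpace X] {v w : X → Vec3} {s : Set X}
    (hv : ContinuousOn v s) (hw : ContinuousOn w s) : ContinuousOn (fun p => v p ⬝ᵥ w p) s :=
  continuousOn_finsetSum _ fun i _ => (continuousOn_pi.1 hv i).mul (continuousOn_pi.1 hw i)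

theorem continuousOn_cross {X : Type*} [TopologicalSpace X] {v w : X → Vec3} {s : Set X}
    (hv : ContinuousOn v s) (hw : ContinuousOn w s) : ContinuousOn (fun p => v p ⨯₃ w p) s := by
  have h : Continuous fun p : Vec3 × Vec3 => hat p.1 *ᵥ p.2 :=
    (continuous_hat.comp continuous_fst).matrix_mulVec continuous_snd
  simp only [← hat_mulVec]
  exact h.comp_continuousOn (f := fun p => (v p, w p)) (hv.prodMk hw)

theorem continuousOn_SL {X : Type*} [TopologicalSpace X] {R : X → Mat3}
    {U : X → Matrix (Fin 3) (Fin n) ℝ} {s : Set X} (hR : ContinuousOn R s)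
    (hU : ContinuousOn U s) : ContinuousOn (fun p => SL (E * W * (U p)ᵀ) (R p)) s := by
  have hL : Continuous fun p : Mat3 × Matrix (Fin 3) (Fin n) ℝ => E * W * p.2ᵀ :=
    continuous_const.matrix_mul continuous_snd.matrix_transpose
  have h : Continuous fun p : Mat3 × Matrix (Fin 3) (Fin n) ℝ => SL (E * W * p.2ᵀ) p.1 :=
    continuous_vex.comp ((hL.matrix_transpose.matrix_mul continuous_fst).sub
      (continuous_fst.matrix_transpose.matrix_mul hL))
  exact h.comp_continuousOn (f := fun p => (R p, U p)) (hR.prodMk hU)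

theorem hasDerivAt_kineticTerm (m : ℝ) (u : Vec3) {v : ℝ → Vec3} {v' : Vec3} {ε : ℝ}
    (hv : HasDerivAt v v' ε) :
    HasDerivAt (fun e => kineticTerm m (v e) u) (-(m * ((u - v ε) ⬝ᵥ v'))) ε := by
  have h : ∀ i, HasDerivAt (fun e => (u - v e) i * (u - v e) i)
      (-v' i * (u - v ε) i + (u - v ε) i * -v' i) ε := fun i => by
    have h0 : HasDerivAt (fun e => (u - v e) i) (-v' i) ε :=
      (hasDerivAt_pi.1 hv i).const_sub (u i)
    exact h0.mul h0
  refine ((HasDerivAt.fun_sum fun i (_ : i ∈ Finset.univ) => h i).const_mul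
    (m / 2)).congr_deriv ?_
  simp only [dotProduct, Finset.mul_sum, ← Finset.sum_neg_distrib]
  exact Finset.sum_congr rfl fun i _ => by ring

end Cost

/-! ### The first variation of the action. -/

section FirstVariation

variable {n : ℕ} {E : Matrix (Fin 3) (Fin n) ℝ} {W : Matrix (Fin n) (Fin n) ℝ} {Φ : ℝ → ℝ}
  {m : ℝ} {D : Mat3} {t₀ T δ : ℝ} {Um : ℝ → Matrix (Fin 3) (Fin n) ℝ} {Ωm : ℝ → Vec3}
  {Rhat : ℝ → Mat3} {Ωhat : ℝ → Vec3} {R : ℝ → ℝ → Mat3} {Ω : ℝ → ℝ → Vec3} {Sig : ℝ → Vec3}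

theorem IsVariation.hasDerivAt_action (hW : W.PosDef) (hΦ : IsCostShape Φ) (hT : t₀ < T)
    (hUm : ContinuousOn Um (Icc t₀ T)) (hΩm : ContinuousOn Ωm (Icc t₀ T))
    (hR : IsTrajectory t₀ T Rhat Ωhat) (hV : IsVariation t₀ T Rhat δ R Ω Sig) :
    HasDerivAt (fun ε => action m Φ E W t₀ T Um Ωm (R ε) (Ω ε))
      (∫ t in t₀..T, (-(m * ((Ωm t - Ωhat t) ⬝ᵥ deriv (fun e => Ω e t) 0)) -
        derivHalfLine Φ (wahbaCost E W (Rhat t) (Um t)) *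
          (SL (E * W * (Um t)ᵀ) (Rhat t) ⬝ᵥ Sig t))) 0 := by
  have hΩ2 : ContinuousOn (fun p : ℝ × ℝ => Ωm p.2) (Ioo (-δ) δ ×ˢ Icc t₀ T) :=
    hΩm.comp continuousOn_snd fun p hp => hp.2
  have hU2 : ContinuousOn (fun p : ℝ × ℝ => Um p.2) (Ioo (-δ) δ ×ˢ Icc t₀ T) :=
    hUm.comp continuousOn_snd fun p hp => hp.2
  have hmul : Continuous fun p : (Mat3 × Mat3) × Matrix (Fin 3) (Fin n) ℝ =>
      traceInner (p.1.2 * p.2) ((E - p.1.1 * p.2) * W) :=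
    continuous_traceInner.comp (((continuous_snd.comp continuous_fst).matrix_mul
      continuous_snd).prodMk ((continuous_const.sub ((continuous_fst.comp
        continuous_fst).matrix_mul continuous_snd)).matrix_mul continuous_const))
  have h := hasDerivAt_integral_of_continuousOn
    (g := fun e t => lagrangian m Φ E W (R e t) (Um t) (Ω e t) (Ωm t))
    (g' := fun e t => -(m * ((Ωm t - Ω e t) ⬝ᵥ deriv (fun e => Ω e t) e)) -
      derivHalfLine Φ (wahbaCost E W (R e t) (Um t)) *
        -traceInner (deriv (fun e => R e t) e * Um t) ((E - R e t * Um t) * W))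
    hV.pos hT.le
    (fun ε hε t ht => (hasDerivAt_kineticTerm m (Ωm t) (hV.hasDerivAt_velocity hε ht)).sub
      (hasDerivAt_comp_wahbaCost hW hΦ (Um t) (hV.hasDerivAt_attitude hε ht)))
    ((continuousOn_const.mul (continuousOn_dotProduct (hΩ2.sub hV.continuousOn_velocity)
        hV.continuous_Ω)).neg.sub
      ((continuousOn_comp_wahbaCost hW hΦ.continuousOn_derivHalfLine
        hV.continuousOn_attitude hU2).mul (hmul.comp_continuousOn
          ((hV.continuousOn_attitude.prodMk hV.continuous_R).prodMk hU2)).neg))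
    (fun ε hε => (continuousOn_const.mul (continuousOn_dotProduct
        (hΩm.sub (hV.trajectory ε hε).continuousOn)
        (hΩm.sub (hV.trajectory ε hε).continuousOn))).sub
      (continuousOn_comp_wahbaCost hW hΦ.contDiffOn.continuousOn
        (hV.trajectory ε hε).continuousOn_attitude hUm))
  refine h.congr_deriv (integral_congr fun t ht => ?_)
  rw [uIcc_of_le hT.le] at ht
  rw [hV.base t ht, hV.velocity_base hT hR ht, hV.deriv_attitude_zero ht,
    traceInner_mul_hat_mul (transpose_eq_of_posDef hW) E (Um t) (hR.mem t ht), neg_neg]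

/-- The right hand side of the angular velocity equation of the filter. -/
noncomputable def filterForce {n : ℕ} (m : ℝ) (Φ : ℝ → ℝ) (E : Matrix (Fin 3) (Fin n) ℝ)
    (W : Matrix (Fin n) (Fin n) ℝ) (D R : Mat3) (U : Matrix (Fin 3) (Fin n) ℝ)
    (Ω w : Vec3) : Vec3 :=
  -(m • (Ω ⨯₃ w)) + derivHalfLine Φ (wahbaCost E W R U) • SL (E * W * Uᵀ) R - D *ᵥ w

theorem continuousOn_filterForce (hW : W.PosDef) (hΦ : IsCostShape Φ) {w : ℝ → Vec3} {s : Set ℝ}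
    (hR : ContinuousOn Rhat s) (hU : ContinuousOn Um s) (hΩ : ContinuousOn Ωhat s)
    (hw : ContinuousOn w s) :
    ContinuousOn (fun t => filterForce m Φ E W D (Rhat t) (Um t) (Ωhat t) (w t)) s :=
  (((continuousOn_cross hΩ hw).const_smul m).neg.add
    ((continuousOn_comp_wahbaCost hW hΦ.continuousOn_derivHalfLine hR hU).smul
      (continuousOn_SL hR hU))).sub
    ((continuous_const.matrix_mulVec continuous_id).comp_continuousOn hw)

/-- The second factor of the last term is Σ̇, so both directions of the equivalence reduce to this
weak form of m ω̇ = F. -/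
theorem IsVariation.exists_hasDerivAt_action_add (hW : W.PosDef) (hΦ : IsCostShape Φ)
    (hT : t₀ < T) (hUm : ContinuousOn Um (Icc t₀ T)) (hΩm : ContinuousOn Ωm (Icc t₀ T))
    (hR : IsTrajectory t₀ T Rhat Ωhat) (hV : IsVariation t₀ T Rhat δ R Ω Sig) :
    ∃ δS : ℝ, HasDerivAt (fun ε => action m Φ E W t₀ T Um Ωm (R ε) (Ω ε)) δS 0 ∧
      δS + ∫ t in t₀..T, (D *ᵥ (Ωm t - Ωhat t)) ⬝ᵥ Sig t =
        -∫ t in t₀..T, (filterForce m Φ E W D (Rhat t) (Um t) (Ωhat t)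
            (Ωm t - Ωhat t) ⬝ᵥ Sig t +
          m * ((Ωm t - Ωhat t) ⬝ᵥ (deriv (fun e => Ω e t) 0 - Ωhat t ⨯₃ Sig t))) := by
  refine ⟨_, hV.hasDerivAt_action hW hΦ hT hUm hΩm hR, ?_⟩
  have hSig : ContinuousOn Sig (Icc t₀ T) := fun t ht =>
    (hV.hasDerivWithinAt_vector hT hR ht).continuousWithinAt
  have hw : ContinuousOn (fun t => Ωm t - Ωhat t) (Icc t₀ T) := hΩm.sub hR.continuousOn
  have hRc := hR.continuousOn_attitude
  rw [← intervalIntegral.integral_add, ← intervalIntegral.integral_neg]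
  · refine integral_congr fun t _ => ?_
    simp only [filterForce, sub_dotProduct, add_dotProduct, neg_dotProduct, smul_dotProduct,
      dotProduct_sub, smul_eq_mul]
    have htriple : ∀ u v w : Vec3, u ⬝ᵥ (v ⨯₃ w) = -((v ⨯₃ u) ⬝ᵥ w) := fun u v w => by
      rw [dotProduct_comm _ w, triple_product_permutation u v w, triple_product_permutation v w u,
        ← dotProduct_neg, cross_anticomm]
    rw [← sub_dotProduct, ← sub_dotProduct, htriple]
    ring
  · exact ((continuousOn_const.mul (continuousOn_dotProduct hw
      hV.continuousOn_deriv_velocity)).neg.sub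
      ((continuousOn_comp_wahbaCost hW hΦ.continuousOn_derivHalfLine hRc hUm).mul
        (continuousOn_dotProduct (continuousOn_SL hRc hUm) hSig))).intervalIntegrable_of_Icc hT.le
  · exact (continuousOn_dotProduct ((continuous_const.matrix_mulVec
      continuous_id).comp_continuousOn hw) hSig).intervalIntegrable_of_Icc hT.le

end FirstVariation

/-! ### Rodrigues' formula for coordinate axes. -/

section AxisRotation

/-- The rotation about the `i`-th coordinate axis by the angle `θ`. -/
noncomputable def axisRotation (i : Fin 3) (θ : ℝ) : Mat3 :=
  1 + Real.sin θ • hat (Pi.single i 1) +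
    (1 - Real.cos θ) • (hat (Pi.single i 1) * hat (Pi.single i 1))

/-- This relation for a unit vector reduces products with the generator to a combination of it and
its square, giving the derivative of Rodrigues' formula. -/
theorem hat_single_cube (i : Fin 3) :
    hat (Pi.single i 1) * hat (Pi.single i 1) * hat (Pi.single i 1) = -hat (Pi.single i 1) := by
  ext j k
  fin_cases i <;> fin_cases j <;> fin_cases k <;>
    simp [hat, Matrix.mul_apply, Fin.sum_univ_three]

theorem axisRotation_zero (i : Fin 3) : axisRotation i 0 = 1 := by
  simp [axisRotation]

theorem axisRotation_mem (i : Fin 3) (θ : ℝ) : axisRotation i θ ∈ SO3 := by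
  have h := Real.sin_sq_add_cos_sq θ
  rw [mem_SO3_iff]
  constructor
  · ext j k
    fin_cases i <;> fin_cases j <;> fin_cases k <;>
      simp [axisRotation, hat, Matrix.mul_apply, Fin.sum_univ_three] <;>
      first | ring1 | linear_combination h
  · rw [Matrix.det_fin_three]
    fin_cases i <;> simp [axisRotation, hat] <;>
      linear_combination h

theorem hasDerivAt_axisRotation (i : Fin 3) (θ : ℝ) :
    HasDerivAt (axisRotation i) (axisRotation i θ * hat (Pi.single i 1)) θ := by
  have hmul : axisRotation i θ * hat (Pi.single i 1) = Real.cos θ • hat (Pi.single i 1) +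
      Real.sin θ • (hat (Pi.single i 1) * hat (Pi.single i 1)) := by
    rw [axisRotation, Matrix.add_mul, Matrix.add_mul, Matrix.smul_mul, Matrix.smul_mul,
      hat_single_cube, Matrix.one_mul]
    module
  rw [hmul, hasDerivAt_matrix]
  intro j k
  simp only [axisRotation, Matrix.add_apply, Matrix.smul_apply, smul_eq_mul]
  have h1 := ((Real.hasDerivAt_sin θ).mul_const (hat (Pi.single i 1) j k)).const_add
    ((1 : Mat3) j k)
  have h2 := ((Real.hasDerivAt_cos θ).const_sub 1).mul_const
    ((hat (Pi.single i 1) * hat (Pi.single i 1)) j k)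
  rw [neg_neg] at h2
  exact h1.add h2

theorem continuous_axisRotation (i : Fin 3) : Continuous (axisRotation i) :=
  continuous_matrix fun j k => continuous_iff_continuousAt.2 fun θ =>
    (hasDerivAt_matrix.1 (hasDerivAt_axisRotation i θ) j k).continuousAt

theorem hasDerivAt_axisRotation_comp (i : Fin 3) {φ : ℝ → ℝ} {φ' t : ℝ} (hφ : HasDerivAt φ φ' t) :
    HasDerivAt (fun s => axisRotation i (φ s))
      (φ' • (axisRotation i (φ t) * hat (Pi.single i 1))) t := by
  refine hasDerivAt_matrix.2 fun j k => ?_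
  have h := (hasDerivAt_matrix.1 (hasDerivAt_axisRotation i (φ t)) j k).comp t hφ
  exact h.congr_deriv (mul_comm _ _)

end AxisRotation

/-! ### Test variations about a body axis. -/

section AxisVariation

variable {t₀ T : ℝ} {Rhat : ℝ → Mat3} {Ωhat : ℝ → Vec3}

/-- Rotating a trajectory by the angle `ε φ` about a body axis is a variation with variation
vector `φ eᵢ`. -/
theorem isVariation_axisRotation (hR : IsTrajectory t₀ T Rhat Ωhat) (i : Fin 3) {φ φ' : ℝ → ℝ}
    (hφ : ∀ t, HasDerivAt φ (φ' t) t) (hφ' : Continuous φ') (h0 : φ t₀ = 0) (h1 : φ T = 0) :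
    IsVariation t₀ T Rhat 1 (fun ε t => Rhat t * axisRotation i (ε * φ t))
      (fun ε t => (axisRotation i (ε * φ t))ᵀ *ᵥ Ωhat t + (ε * φ' t) • Pi.single i 1)
      (fun t => φ t • Pi.single i 1) := by
  have hφc : Continuous φ := continuous_iff_continuousAt.2 fun t => (hφ t).continuousAt
  have hRd : ∀ ε t, HasDerivAt (fun e => Rhat t * axisRotation i (e * φ t))
      (Rhat t * (φ t • (axisRotation i (ε * φ t) * hat (Pi.single i 1)))) ε := fun ε t => by
    have h := hasDerivAt_axisRotation_comp i ((hasDerivAt_id ε).mul_const (φ t))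
    rw [one_mul] at h
    have hc : HasDerivAt (fun _ : ℝ => Rhat t) 0 ε :=
      hasDerivAt_matrix.2 fun j k => hasDerivAt_const ε (Rhat t j k)
    have h2 := hasDerivAt_matrix_mul hc h
    rwa [Matrix.zero_mul, zero_add] at h2
  have hΩd : ∀ ε t, HasDerivAt
      (fun e => (axisRotation i (e * φ t))ᵀ *ᵥ Ωhat t + (e * φ' t) • (Pi.single i 1 : Vec3))
      ((φ t • (axisRotation i (ε * φ t) * hat (Pi.single i 1)))ᵀ *ᵥ Ωhat t +
        φ' t • Pi.single i 1) ε := fun ε t => by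
    have h := hasDerivAt_axisRotation_comp i ((hasDerivAt_id ε).mul_const (φ t))
    rw [one_mul] at h
    rw [hasDerivAt_matrix] at h
    refine hasDerivAt_pi.2 fun j => ?_
    have hA : HasDerivAt (fun e => ((axisRotation i (e * φ t))ᵀ *ᵥ Ωhat t) j)
        (((φ t • (axisRotation i (ε * φ t) * hat (Pi.single i 1)))ᵀ *ᵥ Ωhat t) j) ε := by
      simp only [Matrix.mulVec, dotProduct, Matrix.transpose_apply]
      exact HasDerivAt.fun_sum fun k _ => (h k j).mul_const (Ωhat t k)
    have hB := ((hasDerivAt_id ε).mul_const (φ' t)).mul_const ((Pi.single i 1 : Vec3) j)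
    rw [one_mul] at hB
    exact hA.add hB
  have hRc := hR.continuousOn_attitude
  have hAc : Continuous fun p : ℝ × ℝ => axisRotation i (p.1 * φ p.2) :=
    (continuous_axisRotation i).comp (continuous_fst.mul (hφc.comp continuous_snd))
  have hAd : Continuous fun p : ℝ × ℝ =>
      φ p.2 • (axisRotation i (p.1 * φ p.2) * hat (Pi.single i 1)) :=
    (hφc.comp continuous_snd).smul (hAc.matrix_mul continuous_const)
  have hmul : Continuous fun p : Mat3 × Mat3 => p.1 * p.2 :=
    continuous_fst.matrix_mul continuous_snd
  have hmulVec : Continuous fun p : Mat3 × Vec3 => p.1 *ᵥ p.2 :=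
    continuous_fst.matrix_mulVec continuous_snd
  have hφs : Continuous fun p : ℝ × ℝ => φ' p.2 • (Pi.single i 1 : Vec3) :=
    (hφ'.comp continuous_snd).smul continuous_const
  refine
    { pos := one_pos
      base := fun t _ => by simp [axisRotation_zero]
      trajectory := fun ε _ => ⟨fun t ht => mul_mem_SO3 (hR.mem t ht) (axisRotation_mem i _),
        fun t ht => ?_, ?_⟩
      left := fun ε _ => by simp [h0, axisRotation_zero]
      right := fun ε _ => by simp [h1, axisRotation_zero]
      differentiable_R := fun ε _ t _ => differentiableAt_matrix (hRd ε t)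
      differentiable_Ω := fun ε _ t _ => (hΩd ε t).differentiableAt
      continuous_R := ?_
      continuous_Ω := ?_
      vector := fun t _ => ?_ }
  · have hA := hasDerivAt_axisRotation_comp i ((hφ t).const_mul ε)
    have hA' : HasDerivWithinAt (fun s => axisRotation i (ε * φ s))
        ((ε * φ' t) • (axisRotation i (ε * φ t) * hat (Pi.single i 1))) (Icc t₀ T) t :=
      hasDerivWithinAt_matrix.2 fun j k => (hasDerivAt_matrix.1 hA j k).hasDerivWithinAt
    have h := hasDerivWithinAt_matrix_mul (hR.kinematics t ht) hA'
    convert! h using 1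
    -- For A the axis rotation, the body velocity of R̂A is Aᵀ Ω̂ plus that of A, because (Aᵀ Ω̂)^×
    -- = Aᵀ Ω̂^× A.
    obtain ⟨ho, -⟩ := mem_SO3_iff.1 (axisRotation_mem i (ε * φ t))
    rw [hat_add, hat_smul, hat_transpose_mulVec (axisRotation_mem i _), Matrix.mul_add]
    congr 1
    · simp only [Matrix.mul_assoc]
      rw [← Matrix.mul_assoc (axisRotation i (ε * φ t)) (axisRotation i (ε * φ t))ᵀ,
        mul_eq_one_comm.1 ho, Matrix.one_mul]
    · simp only [Matrix.mul_smul, Matrix.mul_assoc]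
  · have hA1 : Continuous fun t => (axisRotation i (ε * φ t))ᵀ :=
      (hAc.comp (f := fun t => (ε, t)) (by fun_prop)).matrix_transpose
    have hB1 : Continuous fun t => (ε * φ' t) • (Pi.single i 1 : Vec3) :=
      (continuous_const.mul hφ').smul continuous_const
    exact (hmulVec.comp_continuousOn (f := fun t => ((axisRotation i (ε * φ t))ᵀ, Ωhat t))
      (hA1.continuousOn.prodMk hR.continuousOn)).add hB1.continuousOn
  · have h : ContinuousOn (fun p : ℝ × ℝ =>
        Rhat p.2 * (φ p.2 • (axisRotation i (p.1 * φ p.2) * hat (Pi.single i 1))))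
        (Ioo (-1) 1 ×ˢ Icc t₀ T) :=
      hmul.comp_continuousOn (f := fun p : ℝ × ℝ =>
        (Rhat p.2, φ p.2 • (axisRotation i (p.1 * φ p.2) * hat (Pi.single i 1))))
        ((hRc.comp continuousOn_snd fun p hp => hp.2).prodMk hAd.continuousOn)
    exact h.congr fun p _ => deriv_matrix (hRd p.1 p.2)
  · have h : ContinuousOn (fun p : ℝ × ℝ =>
        (φ p.2 • (axisRotation i (p.1 * φ p.2) * hat (Pi.single i 1)))ᵀ *ᵥ Ωhat p.2 +
          φ' p.2 • (Pi.single i 1 : Vec3)) (Ioo (-1) 1 ×ˢ Icc t₀ T) :=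
      (hmulVec.comp_continuousOn (f := fun p : ℝ × ℝ =>
        ((φ p.2 • (axisRotation i (p.1 * φ p.2) * hat (Pi.single i 1)))ᵀ, Ωhat p.2))
        (hAd.matrix_transpose.continuousOn.prodMk
          (hR.continuousOn.comp continuousOn_snd fun p hp => hp.2))).add hφs.continuousOn
    exact h.congr fun p _ => (hΩd p.1 p.2).deriv
  · have h := hRd 0 t
    rwa [zero_mul, axisRotation_zero, Matrix.one_mul, ← hat_smul] at h

end AxisVariation

/-! ### The principle and the weak form of the velocity equation. -/

section Equivalence

variable {n : ℕ} {E : Matrix (Fin 3) (Fin n) ℝ} {W : Matrix (Fin n) (Fin n) ℝ} {Φ : ℝ → ℝ}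
  {m : ℝ} {D : Mat3} {t₀ T : ℝ} {Um : ℝ → Matrix (Fin 3) (Fin n) ℝ} {Ωm : ℝ → Vec3}
  {Rhat : ℝ → Mat3} {Ωhat : ℝ → Vec3}

theorem LagrangeDAlembert.hasDerivWithinAt (hW : W.PosDef) (hΦ : IsCostShape Φ) (hT : t₀ < T)
    (hUm : ContinuousOn Um (Icc t₀ T)) (hΩm : ContinuousOn Ωm (Icc t₀ T))
    (h : LagrangeDAlembert m Φ E W D t₀ T Um Ωm Rhat Ωhat) {t : ℝ} (ht : t ∈ Icc t₀ T) :
    HasDerivWithinAt (fun s => m • (Ωm s - Ωhat s))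
      (filterForce m Φ E W D (Rhat t) (Um t) (Ωhat t) (Ωm t - Ωhat t)) (Icc t₀ T) t := by
  have hR := h.trajectory
  have hw : ContinuousOn (fun t => Ωm t - Ωhat t) (Icc t₀ T) := hΩm.sub hR.continuousOn
  refine hasDerivWithinAt_pi.2 fun i => ?_
  refine hasDerivWithinAt_of_forall_integral_eq_zero hT
    (q := fun t => filterForce m Φ E W D (Rhat t) (Um t) (Ωhat t) (Ωm t - Ωhat t) i)
    (continuousOn_pi.1 (hw.const_smul m) i)
    (continuousOn_pi.1 (continuousOn_filterForce hW hΦ hR.continuousOn_attitude hUm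
      hR.continuousOn hw) i) (fun φ φ' hφ hφ' h0 h1 => ?_) ht
  have hV := isVariation_axisRotation hR i hφ hφ' h0 h1
  obtain ⟨δS, hδ, hzero⟩ := h.stationary _ _ _ _ hV
  obtain ⟨δS', hδ', heq⟩ := hV.exists_hasDerivAt_action_add (D := D) hW hΦ hT hUm hΩm hR
  rw [← hδ.unique hδ', hzero] at heq
  rw [← neg_eq_zero, heq]
  congr 1
  refine integral_congr fun s hs => ?_
  rw [uIcc_of_le hT.le] at hs
  -- Uniqueness of the derivative of Σ = φ eᵢ gives δΩ - Ω̂ × Σ = φ' eᵢ without computing δΩ.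
  have hder := (uniqueDiffOn_Icc hT s hs).eq_deriv _ (hV.hasDerivWithinAt_vector hT hR hs)
    ((hφ s).hasDerivWithinAt.smul_const (Pi.single i 1 : Vec3))
  rw [hder]
  simp
  ring

theorem lagrangeDAlembert_of_hasDerivWithinAt (hW : W.PosDef) (hΦ : IsCostShape Φ) (hT : t₀ < T)
    (hUm : ContinuousOn Um (Icc t₀ T)) (hΩm : ContinuousOn Ωm (Icc t₀ T))
    (hR : IsTrajectory t₀ T Rhat Ωhat)
    (h : ∀ t ∈ Icc t₀ T, HasDerivWithinAt (fun s => m • (Ωm s - Ωhat s))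
      (filterForce m Φ E W D (Rhat t) (Um t) (Ωhat t) (Ωm t - Ωhat t)) (Icc t₀ T) t) :
    LagrangeDAlembert m Φ E W D t₀ T Um Ωm Rhat Ωhat := by
  refine ⟨hR, fun δ R Ω Sig hV => ?_⟩
  obtain ⟨δS, hδ, heq⟩ := hV.exists_hasDerivAt_action_add (D := D) hW hΦ hT hUm hΩm hR
  refine ⟨δS, hδ, ?_⟩
  have hw : ContinuousOn (fun t => Ωm t - Ωhat t) (Icc t₀ T) := hΩm.sub hR.continuousOn
  have hSd := fun t ht => hV.hasDerivWithinAt_vector hT hR (t := t) ht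
  have hSig : ContinuousOn Sig (Icc t₀ T) := fun t ht => (hSd t ht).continuousWithinAt
  have hder : ∀ t ∈ Icc t₀ T, HasDerivWithinAt (fun s => (m • (Ωm s - Ωhat s)) ⬝ᵥ Sig s)
      (filterForce m Φ E W D (Rhat t) (Um t) (Ωhat t) (Ωm t - Ωhat t) ⬝ᵥ Sig t +
        m * ((Ωm t - Ωhat t) ⬝ᵥ (deriv (fun e => Ω e t) 0 - Ωhat t ⨯₃ Sig t)))
      (Icc t₀ T) t := fun t ht => by
    rw [← smul_eq_mul m, ← smul_dotProduct]
    simp only [dotProduct, ← Finset.sum_add_distrib]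
    exact HasDerivWithinAt.fun_sum fun i _ =>
      (hasDerivWithinAt_pi.1 (h t ht) i).mul (hasDerivWithinAt_pi.1 (hSd t ht) i)
  -- The integrand is the derivative of m ω·Σ, so only boundary values remain, and Σ vanishes at
  -- both ends.
  rw [heq, integral_eq_sub_of_hasDerivWithinAt_Icc hT.le hder,
    hV.vector_eq_zero hR (left_mem_Icc.2 hT.le) hV.left,
    hV.vector_eq_zero hR (right_mem_Icc.2 hT.le) hV.right]
  · simp
  · exact (continuousOn_dotProduct (continuousOn_filterForce hW hΦ hR.continuousOn_attitude hUm
      hR.continuousOn hw) hSig).add (continuousOn_const.mul (continuousOn_dotProduct hw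
        (hV.continuousOn_deriv_velocity.sub (continuousOn_cross hR.continuousOn hSig))))

end Equivalence

end AttitudeFilter

theorem mainTheorem3 {n : ℕ} (E : Matrix (Fin 3) (Fin n) ℝ) (W : Matrix (Fin n) (Fin n) ℝ)
    (hW : W.PosDef) (Φ : ℝ → ℝ) (hΦ : AttitudeFilter.IsCostShape Φ) (m : ℝ) (hm : 0 < m)
    (D : AttitudeFilter.Mat3) (hD : D.PosDef) (t₀ T : ℝ) (hT : t₀ < T)
    (Um : ℝ → Matrix (Fin 3) (Fin n) ℝ) (hUm : ContinuousOn Um (Set.Icc t₀ T))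
    (Ωm : ℝ → AttitudeFilter.Vec3) (hΩm : ContinuousOn Ωm (Set.Icc t₀ T))
    (R₀ : AttitudeFilter.Mat3) (Ωhat₀ : AttitudeFilter.Vec3)
    (Rhat : ℝ → AttitudeFilter.Mat3) (Ωhat ω : ℝ → AttitudeFilter.Vec3) :
    (AttitudeFilter.LagrangeDAlembert m Φ E W D t₀ T Um Ωm Rhat Ωhat ∧
        Rhat t₀ = R₀ ∧ Ωhat t₀ = Ωhat₀ ∧ ∀ t ∈ Set.Icc t₀ T, ω t = Ωm t - Ωhat t) ↔
      AttitudeFilter.IsFilter m Φ E W D t₀ T Um Ωm R₀ (Ωm t₀ - Ωhat₀) Rhat Ωhat ω := by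
  have ht₀ : t₀ ∈ Icc t₀ T := left_mem_Icc.2 hT.le
  constructor
  · rintro ⟨hL, rfl, rfl, hω⟩
    have hest : ∀ t ∈ Icc t₀ T, Ωhat t = Ωm t - ω t := fun t ht => by rw [hω t ht]; abel
    refine ⟨hL.trajectory.mem, fun t ht => ?_, fun t ht => ?_, hest, rfl, hω t₀ ht₀⟩
    · rw [← hest t ht]
      exact hL.trajectory.kinematics t ht
    · have h := (hL.hasDerivWithinAt hW hΦ hT hUm hΩm ht).const_smul m⁻¹
      have hd : HasDerivWithinAt ω (m⁻¹ • AttitudeFilter.filterForce m Φ E W D (Rhat t) (Um t)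
          (Ωhat t) (Ωm t - Ωhat t)) (Icc t₀ T) t :=
        h.congr_of_mem (fun s hs => by simp [hω s hs, smul_smul, inv_mul_cancel₀ hm.ne']) ht
      refine ⟨hd.differentiableWithinAt, ?_⟩
      rw [hd.derivWithin (uniqueDiffOn_Icc hT t ht), smul_smul, mul_inv_cancel₀ hm.ne', one_smul,
        ← hω t ht]
      rfl
  · intro h
    have hω : ∀ t ∈ Icc t₀ T, ω t = Ωm t - Ωhat t := fun t ht => by
      rw [h.estimate t ht]; abel
    have hωc : ContinuousOn ω (Icc t₀ T) := fun t ht => (h.velocity t ht).1.continuousWithinAt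
    -- Continuity of Ω̂ = Ωᵐ - ω follows from that of Ωᵐ and the differentiability of ω, so R̂ is
    -- C¹.
    have hR : AttitudeFilter.IsTrajectory t₀ T Rhat Ωhat := by
      refine ⟨h.mem, fun t ht => ?_, (hΩm.sub hωc).congr h.estimate⟩
      rw [h.estimate t ht]
      exact h.attitude t ht
    refine ⟨AttitudeFilter.lagrangeDAlembert_of_hasDerivWithinAt hW hΦ hT hUm hΩm hR
      fun t ht => ?_, h.init_attitude, ?_, hω⟩
    · have hd := (h.velocity t ht).1.hasDerivWithinAt.const_smul m
      rw [(h.velocity t ht).2] at hd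
      rw [← hω t ht]
      exact hd.congr_of_mem (fun s hs => by simp [hω s hs]) ht
    · rw [h.estimate t₀ ht₀, h.init_velocity]
      abel
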